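/- Let $G$ be a locally compact abelian group (written additively), with Pontryagin dual $\widehat G$, the group of continuous homomorphisms $G\to S^1$, also written additively. Let $u:G\to\mathbb R$ be continuous, strictly positive and positive-definite (for all $x_1,\dots,x_n\in G$ the matrix $(u(x_j-x_i))_{i,j}$ is Hermitian and nonnegative-definite), with $u(0)=1$. Let $G_u$ be the group $G$ with the convolution of point measures $$\delta_x*\delta_y=\frac{u(x)u(y)}{u(x+y)}\,\delta_{x+y}.$$ A symmetric quasi-character of $G_u$ is a function $\varphi:G\to\mathbb C$ with $\varphi(x)\varphi(y)=\int_G\varphi\,d(\delta_x*\delta_y)$ and $\varphi(-x)=\overline{\varphi(x)}$ for all $x,y\in G$. Let $\hat u$ be the Fourier transform of $u$, i.e. the bounded (nonnegative) Radon measure on $\widehat G$ with $u(x)=\int_{\widehat G}\chi(x)\,d\hat u(\chi)$ for all $x\in G$, and let $T_\psi\hat u$ denote the translate of $\hat u$ by $\psi\in\widehat G$, i.e. its image under $\chi\mapsto\psi+\chi$. Then: 1. For every $\chi\in\widehat G$ the function $\chi u$ is a symmetric quasi-character of $G_u$, and every continuous symmetric quasi-character of $G_u$ that is not identically zero equals $\chi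 u$ for exactly one $\chi\in\widehat G$. 2. These functions multiply according to the convolution $\delta_{\chi_1}*\delta_{\chi_2}=T_{\chi_1+\chi_2}\hat u$ on $\widehat G$: for all $\chi_1,\chi_2\in\widehat G$ and $x\in G$, the function $\chi\mapsto\chi(x)u(x)$ is integrable with respect to $T_{\chi_1+\chi_2}\hat u$, and $$(\chi_1(x)u(x))\,(\chi_2(x)u(x))=\int_{\widehat G}\chi(x)u(x)\,d(T_{\chi_1+\chi_2}\hat u)(\chi).$$ -/

import Mathlib

/-!
Ghost-spaces over a locally compact abelian group. The groups are written multiplicatively, as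
Mathlib's `PontryaginDual` is: `x * y`, `x⁻¹`, `1` stand for `x + y`, `-x`, `0`.
-/

namespace GhostSpace

open MeasureTheory
open scoped ComplexOrder

noncomputable section

/-- A complex function `f` on a group is positive-definite if all the matrices
`(f (x_j - x_i))_{i,j}` are Hermitian and nonnegative-definite. -/
def IsPositiveDefinite {G : Type*} [CommGroup G] (f : G → ℂ) : Prop :=
  ∀ (n : ℕ) (x : Fin n → G), (Matrix.of fun i j => f (x j * (x i)⁻¹)).PosSemidef

/-- The functions `u` that define a ghost-space of the first kind `G_u`: strictly positive,
positive-definite, continuous, with value `1` at the neutral element. -/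
structure IsGhostFunction {G : Type*} [CommGroup G] [TopologicalSpace G] (u : G → ℝ) : Prop where
  pos : ∀ x, 0 < u x
  positiveDefinite : IsPositiveDefinite fun x => (u x : ℂ)
  continuous : Continuous u
  map_one : u 1 = 1

/-- The convolution of point measures in `G_u`, namely
`δ_x * δ_y = (u(x) u(y) / u(x+y)) δ_{x+y}`. -/
def firstKindConv {G : Type*} [CommGroup G] [MeasurableSpace G] (u : G → ℝ) (x y : G) :
    Measure G :=
  ENNReal.ofReal (u x * u y / u (x * y)) • Measure.dirac (x * y)

/-- The translate `T_a μ` of a measure. -/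
def translateMeasure {H : Type*} [CommGroup H] [MeasurableSpace H] (a : H) (μ : Measure H) : Measure H :=
  μ.map fun b => a * b

/-- The convolution of point measures in `H^μ`, namely `δ_a * δ_b = T_{a+b} μ`. -/
def secondKindConv {H : Type*} [CommGroup H] [MeasurableSpace H] (μ : Measure H) (a b : H) :
    Measure H :=
  translateMeasure (a * b) μ

/-- A symmetric quasi-character of a convolution structure `(x, y) ↦ δ_x * δ_y` on `G`: a function
with `φ(x) φ(y) = ∫ φ d(δ_x * δ_y)` and `φ(-x) = conj φ(x)`. -/
structure IsSymmQuasiCharacter {G : Type*} [CommGroup G] [MeasurableSpace G]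
    (conv : G → G → Measure G) (φ : G → ℂ) : Prop where
  mul_eq : ∀ x y, φ x * φ y = ∫ z, φ z ∂(conv x y)
  symm : ∀ x, φ x⁻¹ = starRingEnd ℂ (φ x)

/-- The function `φ_χ(x) = χ(x) u(x)` on `G`, for a character `χ`. -/
def quasiChar {G : Type*} [CommGroup G] [TopologicalSpace G] (u : G → ℝ) (χ : PontryaginDual G)
    (x : G) : ℂ :=
  (χ x : ℂ) * (u x : ℂ)

/-- The inverse Fourier transform `x ↦ ∫ χ(x) dμ(χ)` of a measure on the dual group. -/
def inverseFourier {G : Type*} [CommGroup G] [TopologicalSpace G]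
    [MeasurableSpace (PontryaginDual G)] (μ : Measure (PontryaginDual G)) (x : G) : ℂ :=
  ∫ χ, (χ x : ℂ) ∂μ

/-- `μ` is the Fourier transform `û` of `u`: the bounded Radon measure on the dual group whose
inverse Fourier transform is `u`. -/
structure IsFourierTransform {G : Type*} [CommGroup G] [TopologicalSpace G]
    [MeasurableSpace (PontryaginDual G)] (u : G → ℝ) (μ : Measure (PontryaginDual G)) : Prop where
  finite : IsFiniteMeasure μ
  regular : μ.Regular
  inverseFourier_eq : ∀ x, (u x : ℂ) = inverseFourier μ x

end

end GhostSpace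

namespace GhostSpace

open MeasureTheory

variable {G : Type*} [CommGroup G] [TopologicalSpace G]

/-! The weight `u x * u y / u (x * y)` is a coboundary, so dividing a quasi-character by `u` makes
it multiplicative. As `u` is even, the quotient still turns inversion into conjugation, which forces
modulus 1: it is a unitary character (`exists_pontryaginDual_of_map_mul`), and `u ≠ 0` makes it
unique. For the dual product, integrating `χ x * u x` against a translate of `û` by `ψ` pulls out `ψ
x * u x` and leaves the inverse Fourier transform of `û`, which is the second factor `u x`. -/

theorem IsGhostFunction.map_inv {u : G → ℝ} (hu : IsGhostFunction u) (x : G) : u x⁻¹ = u x := by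
  -- The off-diagonal entries of this Hermitian matrix are the real numbers `u x` and `u x⁻¹`.
  have h := (hu.positiveDefinite 2 ![1, x]).1.apply 0 1
  simpa using h

theorem continuous_quasiChar {u : G → ℝ} (hu : Continuous u) (χ : PontryaginDual G) :
    Continuous (quasiChar u χ) := by
  unfold quasiChar
  exact (continuous_subtype_val.comp (map_continuous χ)).mul (Complex.continuous_ofReal.comp hu)

theorem integral_firstKindConv [MeasurableSpace G] [BorelSpace G] {u : G → ℝ}
    (hu : IsGhostFunction u) {φ : G → ℂ} (hφ : Continuous φ) (x y : G) :
    ∫ z, φ z ∂(firstKindConv u x y) = (u x * u y / u (x * y) : ℂ) * φ (x * y) := by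
  have h : 0 ≤ u x * u y / u (x * y) :=
    div_nonneg (mul_nonneg (hu.pos x).le (hu.pos y).le) (hu.pos _).le
  rw [firstKindConv, integral_smul_measure, integral_dirac' _ _ hφ.stronglyMeasurable,
    ENNReal.toReal_ofReal h, Complex.real_smul]
  push_cast
  rfl

theorem isSymmQuasiCharacter_quasiChar [MeasurableSpace G] [BorelSpace G] {u : G → ℝ}
    (hu : IsGhostFunction u) (χ : PontryaginDual G) :
    IsSymmQuasiCharacter (firstKindConv u) (quasiChar u χ) where
  mul_eq x y := by
    have h : (u (x * y) : ℂ) ≠ 0 := Complex.ofReal_ne_zero.2 (hu.pos _).ne'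
    rw [integral_firstKindConv hu (continuous_quasiChar hu.continuous χ)]
    simp only [quasiChar, map_mul, Circle.coe_mul]
    field_simp
  symm x := by
    rw [quasiChar, quasiChar, hu.map_inv, map_inv, Circle.coe_inv_eq_conj, map_mul,
      Complex.conj_ofReal]

theorem quasiChar_injective {u : G → ℝ} (hu : IsGhostFunction u) :
    Function.Injective (quasiChar u) := by
  intro χ χ' h
  refine DFunLike.ext _ _ fun x => Circle.ext ?_
  exact mul_right_cancel₀ (Complex.ofReal_ne_zero.2 (hu.pos x).ne') (congrFun h x)

/-- A continuous multiplicative function to `ℂ`, not identically zero, that intertwines inversion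
and conjugation is a unitary character. -/
theorem exists_pontryaginDual_of_map_mul {ψ : G → ℂ} (hc : Continuous ψ) (h0 : ψ ≠ 0)
    (hmul : ∀ x y, ψ (x * y) = ψ x * ψ y) (hinv : ∀ x, ψ x⁻¹ = starRingEnd ℂ (ψ x)) :
    ∃ χ : PontryaginDual G, ∀ x, (χ x : ℂ) = ψ x := by
  obtain ⟨a, ha⟩ := Function.ne_iff.1 h0
  have hone : ψ 1 = 1 := by
    have h := hmul 1 a
    rw [one_mul] at h
    exact mul_right_cancel₀ ha (by rw [← h, one_mul])
  -- `‖ψ x‖ ^ 2 = ψ x * conj (ψ x) = ψ (x * x⁻¹) = ψ 1 = 1`.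
  have hnorm (x : G) : ‖ψ x‖ = 1 := by
    have h := hmul x x⁻¹
    rw [mul_inv_cancel, hone, hinv, Complex.mul_conj'] at h
    have h' : ‖ψ x‖ ^ 2 = 1 := by exact_mod_cast h.symm
    exact (pow_eq_one_iff_of_nonneg (norm_nonneg _) two_ne_zero).1 h'
  let χ : G →ₜ* Circle :=
    { toFun := fun x => ⟨ψ x, mem_sphere_zero_iff_norm.2 (hnorm x)⟩
      map_one' := Circle.ext hone
      map_mul' := fun x y => Circle.ext (hmul x y)
      continuous_toFun := hc.subtype_mk _ }
  exact ⟨χ, fun _ => rfl⟩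

theorem exists_eq_quasiChar [MeasurableSpace G] [BorelSpace G] {u : G → ℝ}
    (hu : IsGhostFunction u) {φ : G → ℂ} (hc : Continuous φ) (h0 : φ ≠ 0)
    (hφ : IsSymmQuasiCharacter (firstKindConv u) φ) :
    ∃ χ : PontryaginDual G, φ = quasiChar u χ := by
  have hne (x : G) : (u x : ℂ) ≠ 0 := Complex.ofReal_ne_zero.2 (hu.pos x).ne'
  obtain ⟨χ, hχ⟩ := exists_pontryaginDual_of_map_mul (ψ := fun x => φ x / u x)
    (hc.div (Complex.continuous_ofReal.comp hu.continuous) hne)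
    (fun h => h0 <| funext fun x => by simpa [hne x] using congrFun h x)
    (fun x y => by
      have h := hφ.mul_eq x y
      rw [integral_firstKindConv hu hc] at h
      have hx := hne x
      have hy := hne y
      have hxy := hne (x * y)
      rw [div_mul_div_comm, h]
      field_simp)
    (fun x => by simp [hφ.symm, hu.map_inv])
  exact ⟨χ, funext fun x => by rw [quasiChar, hχ, div_mul_cancel₀ _ (hne x)]⟩

/-- The dual carries the topology induced from `C(G, Circle)`, where point evaluations are
continuous. This gives the measurability of the integrands on the dual. -/
theorem continuous_eval_pontryaginDual (x : G) :
    Continuous fun χ : PontryaginDual G => (χ x : ℂ) :=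
  continuous_subtype_val.comp
    ((ContinuousEvalConst.continuous_eval_const (F := C(G, Circle)) x).comp
      (ContinuousMonoidHom.isInducing_toContinuousMap G Circle).continuous)

section Dual

variable [MeasurableSpace (PontryaginDual G)] [BorelSpace (PontryaginDual G)]

theorem integrable_quasiChar (u : G → ℝ) (μ : Measure (PontryaginDual G)) [IsFiniteMeasure μ]
    (x : G) : Integrable (fun χ : PontryaginDual G => quasiChar u χ x) μ := by
  refine Integrable.of_bound (C := ‖(u x : ℂ)‖)
    ((continuous_eval_pontryaginDual x).mul continuous_const).aestronglyMeasurable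
    (Filter.Eventually.of_forall fun χ => ?_)
  rw [quasiChar, norm_mul, Circle.norm_coe, one_mul]

/-- Evaluation at `x` is multiplicative in the character, so the translation by `ψ` contributes only
the constant factor `ψ x`. -/
theorem integral_quasiChar_translateMeasure (u : G → ℝ) (μ : Measure (PontryaginDual G))
    (ψ : PontryaginDual G) (x : G) :
    ∫ χ, quasiChar u χ x ∂(translateMeasure ψ μ) = quasiChar u ψ x * inverseFourier μ x := by
  have hcont : Continuous fun χ : PontryaginDual G => quasiChar u χ x :=
    (continuous_eval_pontryaginDual x).mul continuous_const
  rw [translateMeasure, integral_map (continuous_const_mul ψ).measurable.aemeasurable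
    hcont.aestronglyMeasurable, inverseFourier, ← integral_const_mul]
  refine integral_congr_ae (Filter.Eventually.of_forall fun χ => ?_)
  change ((ψ x * χ x : Circle) : ℂ) * (u x : ℂ) = (ψ x : ℂ) * (u x : ℂ) * (χ x : ℂ)
  rw [Circle.coe_mul]
  ring

end Dual

end GhostSpace

theorem proposition4p1 {G : Type*} [CommGroup G] [TopologicalSpace G] [IsTopologicalGroup G]
    [LocallyCompactSpace G] [MeasurableSpace G] [BorelSpace G]
    [MeasurableSpace (PontryaginDual G)] [BorelSpace (PontryaginDual G)]
    (u : G → ℝ) (hu : GhostSpace.IsGhostFunction u)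
    (uHat : MeasureTheory.Measure (PontryaginDual G))
    (huHat : GhostSpace.IsFourierTransform u uHat) :
    (∀ χ : PontryaginDual G, GhostSpace.IsSymmQuasiCharacter (GhostSpace.firstKindConv u)
      (GhostSpace.quasiChar u χ)) ∧
    (∀ φ : G → ℂ, Continuous φ → φ ≠ 0 →
      GhostSpace.IsSymmQuasiCharacter (GhostSpace.firstKindConv u) φ →
        ∃! χ : PontryaginDual G, φ = GhostSpace.quasiChar u χ) ∧
    (∀ (χ₁ χ₂ : PontryaginDual G) (x : G),
      MeasureTheory.Integrable (fun χ : PontryaginDual G => GhostSpace.quasiChar u χ x)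
        (GhostSpace.secondKindConv uHat χ₁ χ₂) ∧
      GhostSpace.quasiChar u χ₁ x * GhostSpace.quasiChar u χ₂ x =
        ∫ χ, GhostSpace.quasiChar u χ x ∂(GhostSpace.secondKindConv uHat χ₁ χ₂)) := by
  refine ⟨GhostSpace.isSymmQuasiCharacter_quasiChar hu, fun φ hc h0 hφ => ?_,
    fun χ₁ χ₂ x => ⟨?_, ?_⟩⟩
  · obtain ⟨χ, rfl⟩ := GhostSpace.exists_eq_quasiChar hu hc h0 hφ
    exact ⟨χ, rfl, fun χ' h => GhostSpace.quasiChar_injective hu h.symm⟩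
  · have := huHat.finite
    have : MeasureTheory.IsFiniteMeasure (GhostSpace.secondKindConv uHat χ₁ χ₂) :=
      MeasureTheory.Measure.isFiniteMeasure_map _ _
    exact GhostSpace.integrable_quasiChar u _ x
  · rw [GhostSpace.secondKindConv, GhostSpace.integral_quasiChar_translateMeasure,
      ← huHat.inverseFourier_eq]
    -- One factor `u x` comes from the integrand, the other from `û`; the product of characters is
    -- pointwise by definition.
    change _ = ((χ₁ x * χ₂ x : Circle) : ℂ) * (u x : ℂ) * (u x : ℂ)
    rw [Circle.coe_mul, GhostSpace.quasiChar, GhostSpace.quasiChar]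
    ring
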